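/- Let $\overline{\mathbb C}=\mathbb C\cup\{\infty\}$. A matrix pencil $\mathcal A(s)=sE-A$ with $E,A\in\mathbb C^{n\times n}$ is called regular if $\det(sE-A)$ is not the zero polynomial. Its rank is the largest $r$ such that the polynomial matrix $sE-A$ has a minor of size $r$ that is not the zero polynomial. Its spectrum $\sigma(\mathcal A)\subseteq\overline{\mathbb C}$ consists of all $\lambda\in\mathbb C$ for which $0$ is an eigenvalue of $\lambda E-A$, together with $\infty$ if $E$ is singular. A Jordan chain of length $m\ge 1$ of $\mathcal A$ at $\lambda\in\mathbb C$ consists of vectors $g_0,\dots,g_{m-1}\in\mathbb C^n$ with $g_0\ne 0$, $(A-\lambda E)g_0=0$ and $(A-\lambda E)g_{i+1}=Eg_i$ for $0\le i\le m-2$; a Jordan chain of length $m$ at $\infty$ consists of vectors with $g_0\neq 0$, $Eg_0=0$ and $Eg_{i+1}=Ag_i$ for $0\le i\le m-2$. Let $\mathcal L_\lambda(\mathcal A)$ be the subspace of $\mathbb C^n$ formed by the zero vector and all elements of all Jordan chains of $\mathcal A$ at $\lambda\in\overline{\mathbb C}$. For a regular pencil $\mathcal A$ and $\lambda\in\sigma(\mathcal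 A)$ let $m_1(\lambda)$ be the length of the longest Jordan chain of $\mathcal A$ at $\lambda$, and put $M(\mathcal A)=\sum_{\mu\in\sigma(\mathcal A)}m_1(\mu)$ (the spectrum of a regular pencil is finite). Theorem. Let $\mathcal A(s)=sE-A$ be a regular matrix pencil with $E,A\in\mathbb C^{n\times n}$, and let $\mathcal P(s)=sF-G$ with $F,G\in\mathbb C^{n\times n}$ be a pencil of rank one such that $(\mathcal A+\mathcal P)(s)=s(E+F)-(A+G)$ is regular. Then for every $\lambda\in\sigma(\mathcal A)$ $$\dim\mathcal L_\lambda(\mathcal A)-m_1(\lambda)\le\dim\mathcal L_\lambda(\mathcal A+\mathcal P)\le\dim\mathcal L_\lambda(\mathcal A)+M(\mathcal A)-m_1(\lambda),$$ and for every $\lambda\in\overline{\mathbb C}\setminus\sigma(\mathcal A)$ $$0\le\dim\mathcal L_\lambda(\mathcal A+\mathcal P)\le M(\mathcal A).$$ Moreover, $$\sum_{\lambda\in\sigma(\mathcal A)}\dim\mathcal L_\lambda(\mathcal A+\mathcal P)\ge n-M(\mathcal A),\qquad \sum_{\lambda\in\sigma(\mathcal A+\mathcal P)\setminus\sigma(\mathcal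 A)}\dim\mathcal L_\lambda(\mathcal A+\mathcal P)\le M(\mathcal A).$$ -/

import Mathlib

/-- A square matrix pencil `s E - A` with `E, A ∈ ℂ^{n × n}`. -/
@[ext]
structure MatrixPencil (n : ℕ) where
  /-- the coefficient of `s` -/
  E : Matrix (Fin n) (Fin n) ℂ
  /-- minus the constant coefficient -/
  A : Matrix (Fin n) (Fin n) ℂ

namespace MatrixPencil

open Polynomial

variable {n : ℕ}

/-- `(sE - A) + (sF - G) = s(E + F) - (A + G)`. -/
instance : Add (MatrixPencil n) := ⟨fun 𝒜 P => ⟨𝒜.E + P.E, 𝒜.A + P.A⟩⟩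

/-- The value `z E - A` of the pencil at a complex number `z`. -/
def eval (𝒜 : MatrixPencil n) (z : ℂ) : Matrix (Fin n) (Fin n) ℂ := z • 𝒜.E - 𝒜.A

/-- The pencil `s E - A` as a matrix with polynomial entries. -/
noncomputable def toPolyMatrix (𝒜 : MatrixPencil n) : Matrix (Fin n) (Fin n) ℂ[X] :=
  (X : ℂ[X]) • 𝒜.E.map C - 𝒜.A.map C

/-- The pencil is regular: its characteristic polynomial `det (s E - A)` is not zero. -/
def IsRegular (𝒜 : MatrixPencil n) : Prop := 𝒜.toPolyMatrix.det ≠ 0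

/-- The rank of a pencil: the largest `r` such that some minor of size `r` of the polynomial matrix
`s E - A` is not the zero polynomial. (The empty minor is `1`, and `r ≤ n` for every minor.) -/
noncomputable def rank (𝒜 : MatrixPencil n) : ℕ :=
  sSup {r : ℕ | ∃ f g : Fin r ↪ Fin n, (𝒜.toPolyMatrix.submatrix f g).det ≠ 0}

/-- The spectrum, a subset of `ℂ ∪ {∞}`: a complex number `z` belongs to it if `0` is an eigenvalue
of the matrix `z E - A`, and `∞` belongs to it if `E` is not invertible. -/
def spectrum (𝒜 : MatrixPencil n) : Set (OnePoint ℂ) :=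
  {l | match l with
    | OnePoint.some z => Module.End.HasEigenvalue (Matrix.toLin' (𝒜.eval z)) 0
    | OnePoint.infty => ¬ IsUnit 𝒜.E}

/-- `g 0, …, g (m - 1)` is a Jordan chain of length `m` of the pencil at a point of `ℂ ∪ {∞}`.
Only the values of `g` at indices below `m` are used. -/
def IsJordanChain (𝒜 : MatrixPencil n) (l : OnePoint ℂ) (m : ℕ) (g : ℕ → Fin n → ℂ) : Prop :=
  0 < m ∧ g 0 ≠ 0 ∧
    match l with
    | OnePoint.some z =>
        (𝒜.A - z • 𝒜.E).mulVec (g 0) = 0 ∧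
          ∀ i, i + 1 < m → (𝒜.A - z • 𝒜.E).mulVec (g (i + 1)) = 𝒜.E.mulVec (g i)
    | OnePoint.infty =>
        𝒜.E.mulVec (g 0) = 0 ∧
          ∀ i, i + 1 < m → 𝒜.E.mulVec (g (i + 1)) = 𝒜.A.mulVec (g i)

/-- The root subspace at `l`: the subspace of all elements of all Jordan chains at `l`. The span
only adds the zero vector to the set of these elements, see `coe_rootSubspace`. -/
def rootSubspace (𝒜 : MatrixPencil n) (l : OnePoint ℂ) : Submodule ℂ (Fin n → ℂ) :=
  Submodule.span ℂ {x | ∃ m g, 𝒜.IsJordanChain l m g ∧ ∃ j < m, g j = x}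

/-- The length of the longest Jordan chain at `l`. For a regular pencil the elements of a Jordan
chain are linearly independent, so that the lengths are bounded by `n`; there is no chain, and the
value is `0`, if `l` is not an eigenvalue. -/
noncomputable def maxChainLength (𝒜 : MatrixPencil n) (l : OnePoint ℂ) : ℕ :=
  sSup {m : ℕ | ∃ g, 𝒜.IsJordanChain l m g}

/-- The sum over all eigenvalues of the length of the longest Jordan chain. The spectrum of a
regular pencil is finite, see `IsRegular.finite_spectrum`. -/
noncomputable def sumMaxChainLength (𝒜 : MatrixPencil n) : ℕ :=
  ∑ᶠ l ∈ 𝒜.spectrum, 𝒜.maxChainLength l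

theorem eval_det_toPolyMatrix (𝒜 : MatrixPencil n) (z : ℂ) :
    𝒜.toPolyMatrix.det.eval z = (𝒜.eval z).det := by
  rw [← coe_evalRingHom, RingHom.map_det]
  congr 1
  ext i j
  simp [toPolyMatrix, eval]
  exact mul_comm _ _

theorem coe_mem_spectrum_iff (𝒜 : MatrixPencil n) (z : ℂ) :
    ((z : OnePoint ℂ) ∈ 𝒜.spectrum) ↔ 𝒜.toPolyMatrix.det.IsRoot z := by
  change Module.End.HasEigenvalue (Matrix.toLin' (𝒜.eval z)) 0 ↔ _
  rw [IsRoot.def, eval_det_toPolyMatrix, ← Matrix.exists_mulVec_eq_zero_iff]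
  constructor
  · intro h
    obtain ⟨v, hv⟩ := h.exists_hasEigenvector
    exact ⟨v, hv.2, by simpa using hv.apply_eq_smul⟩
  · rintro ⟨v, hv, h⟩
    refine Module.End.hasEigenvalue_of_hasEigenvector (x := v) ⟨?_, hv⟩
    rw [Module.End.mem_eigenspace_iff]
    simpa using h

theorem IsRegular.finite_spectrum {𝒜 : MatrixPencil n} (h : 𝒜.IsRegular) :
    𝒜.spectrum.Finite := by
  refine (((finite_setOfPred_isRoot h).image OnePoint.some).insert OnePoint.infty).subset ?_
  intro l hl
  induction l using OnePoint.rec with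
  | infty => exact Or.inl rfl
  | coe z => exact Or.inr ⟨z, (𝒜.coe_mem_spectrum_iff z).1 hl, rfl⟩

/-- The left and the right matrix in the recursion of Jordan chains at `l`. -/
def chainMatrices (𝒜 : MatrixPencil n) (l : OnePoint ℂ) :
    Matrix (Fin n) (Fin n) ℂ × Matrix (Fin n) (Fin n) ℂ :=
  match l with
  | OnePoint.some z => (𝒜.A - z • 𝒜.E, 𝒜.E)
  | OnePoint.infty => (𝒜.E, 𝒜.A)

theorem isJordanChain_iff (𝒜 : MatrixPencil n) (l : OnePoint ℂ) (m : ℕ) (g : ℕ → Fin n → ℂ) :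
    𝒜.IsJordanChain l m g ↔ 0 < m ∧ g 0 ≠ 0 ∧ (𝒜.chainMatrices l).1.mulVec (g 0) = 0 ∧
      ∀ i, i + 1 < m →
        (𝒜.chainMatrices l).1.mulVec (g (i + 1)) = (𝒜.chainMatrices l).2.mulVec (g i) := by
  induction l using OnePoint.rec <;> rfl

/-- The root subspace consists of the zero vector and the elements of Jordan chains. -/
theorem coe_rootSubspace (𝒜 : MatrixPencil n) (l : OnePoint ℂ) :
    (𝒜.rootSubspace l : Set (Fin n → ℂ)) =
      insert 0 {x | ∃ m g, 𝒜.IsJordanChain l m g ∧ ∃ j < m, g j = x} := by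
  set K := (𝒜.chainMatrices l).1
  set R := (𝒜.chainMatrices l).2
  -- reversed chains `x = h 0, h 1, …` that are eventually zero
  let W : Submodule ℂ (Fin n → ℂ) :=
    { carrier := {x | ∃ h : ℕ → Fin n → ℂ, h 0 = x ∧
        (∀ i, K.mulVec (h i) = R.mulVec (h (i + 1))) ∧ ∃ N, ∀ i, N ≤ i → h i = 0}
      zero_mem' := ⟨fun _ => 0, rfl, by simp, 0, by simp⟩
      add_mem' := by
        rintro x y ⟨h, hx, h1, N, hN⟩ ⟨h', hy, h1', N', hN'⟩
        refine ⟨h + h', by simp [hx, hy], fun i => ?_, max N N', fun i hi => ?_⟩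
        · simp [Matrix.mulVec_add, h1, h1']
        · simp [hN i (by omega), hN' i (by omega)]
      smul_mem' := by
        rintro c x ⟨h, hx, h1, N, hN⟩
        refine ⟨c • h, by simp [hx], fun i => ?_, N, fun i hi => ?_⟩
        · simp [Matrix.mulVec_smul, h1]
        · simp [hN i hi] }
  apply Set.Subset.antisymm
  · have hle : 𝒜.rootSubspace l ≤ W := by
      refine Submodule.span_le.2 ?_
      rintro x ⟨m, g, hg, j, hj, rfl⟩
      obtain ⟨-, -, h0, h1⟩ := (𝒜.isJordanChain_iff l m g).1 hg
      refine ⟨fun i => if i ≤ j then g (j - i) else 0, by simp, fun i => ?_, j + 1, fun i hi => ?_⟩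
      · rcases lt_trichotomy i j with h | h | h
        · have := h1 (j - (i + 1)) (by omega)
          rw [show j - (i + 1) + 1 = j - i by omega] at this
          simpa [h.le, Nat.succ_le_of_lt h] using this
        · subst h
          simpa using h0
        · simp [not_le.2 h, show ¬ (i + 1 ≤ j) by omega]
      · simp [show ¬ (i ≤ j) by omega]
    intro x hx
    obtain ⟨h, rfl, h1, hN⟩ := hle hx
    by_cases h0 : h 0 = 0
    · exact Or.inl h0
    right
    classical
    -- the first index at which the reversed chain vanishes
    have hex : ∃ N, h N = 0 := ⟨hN.choose, hN.choose_spec _ le_rfl⟩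
    have hm : h (Nat.find hex) = 0 := Nat.find_spec hex
    have hmin : ∀ i < Nat.find hex, h i ≠ 0 := fun i hi => Nat.find_min hex hi
    generalize Nat.find hex = m at hm hmin
    have hpos : 0 < m := by
      rcases Nat.eq_zero_or_pos m with rfl | hp
      · exact absurd hm h0
      · exact hp
    refine ⟨m, fun i => h (m - 1 - i), (𝒜.isJordanChain_iff l _ _).2
      ⟨hpos, hmin _ (by omega), ?_, fun i hi => ?_⟩, m - 1, by omega, by simp⟩
    · have := h1 (m - 1)
      rw [show m - 1 + 1 = m by omega, hm] at this
      simpa using this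
    · have := h1 (m - 1 - (i + 1))
      rwa [show m - 1 - (i + 1) + 1 = m - 1 - i by omega] at this
  · rintro x (rfl | hx)
    · exact zero_mem _
    · exact Submodule.subset_span hx

end MatrixPencil

/-! At each point of `ℂ ∪ {∞}` the dimension of the root subspace of a regular pencil is the
order of vanishing of its determinant `det M` in a local coordinate. Jordan chains are the Taylor
coefficients of polynomial vectors `u` with `u 0 ≠ 0` for which `M u` vanishes to the order of the
length. If `det M` vanishes to order `v` and `w` is the least order of vanishing in a column of
`adj M`, then dividing that column by the power `w` of the coordinate leaves such a `u` of order
`v - w`, so `v - w ≤ m₁`: all of `adj M` is divisible by the power `v - m₁` of the coordinate.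
For `Q` of rank one `det (M + Q) = det M + tr (adj M * Q)`, so the perturbation lowers the
multiplicity at a point by at most `m₁`. As the multiplicities add up to `n` before and after the
perturbation, what is gained at some points is lost at others, which bounds the gain. -/

section PolynomialMatrices

open Polynomial Matrix

variable {ι R : Type*} [CommRing R]

theorem X_pow_dvd_iff_le_natTrailingDegree {p : R[X]} (hp : p ≠ 0) {k : ℕ} :
    X ^ k ∣ p ↔ k ≤ p.natTrailingDegree := by
  rw [X_pow_dvd_iff]
  refine ⟨le_natTrailingDegree hp, fun hk d hd => ?_⟩
  exact coeff_eq_zero_of_lt_natTrailingDegree (hd.trans_le hk)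

theorem exists_eq_X_pow_smul_coeff_zero_ne_zero {u : ι → R[X]} (hu : u ≠ 0) :
    ∃ (k : ℕ) (v : ι → R[X]), u = (X : R[X]) ^ k • v ∧ (fun i => (v i).coeff 0) ≠ 0 := by
  classical
  obtain ⟨i, hi⟩ := Function.ne_iff.1 hu
  have hex : ∃ k i, (u i).coeff k ≠ 0 := by
    by_contra! h
    exact hi (Polynomial.ext fun k => by simp [h k i])
  have hdvd : ∀ i, X ^ Nat.find hex ∣ u i := fun i => X_pow_dvd_iff.2 fun d hd => by
    by_contra h
    exact Nat.find_min hex hd ⟨i, h⟩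
  choose v hv using hdvd
  refine ⟨Nat.find hex, v, funext hv, ?_⟩
  obtain ⟨j, hj⟩ := Nat.find_spec hex
  refine Function.ne_iff.2 ⟨j, ?_⟩
  rwa [hv j, coeff_X_pow_mul', if_pos le_rfl, Nat.sub_self] at hj

/-- A root polynomial of order at least `m` at `0` of a polynomial matrix `M`: a polynomial vector
`u` with `u 0 ≠ 0` such that `M u` vanishes at `0` to order at least `m`. -/
def IsRootPolynomial [Fintype ι] (M : Matrix ι ι R[X]) (m : ℕ) (u : ι → R[X]) : Prop :=
  (fun i => (u i).coeff 0) ≠ 0 ∧ ∀ i, X ^ m ∣ (M *ᵥ u) i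

variable [Fintype ι] [DecidableEq ι] [IsDomain R] {M : Matrix ι ι R[X]}

theorem IsRootPolynomial.X_pow_dvd_det {m : ℕ} {u : ι → R[X]} (hu : IsRootPolynomial M m u) :
    X ^ m ∣ M.det := by
  obtain ⟨j, hj⟩ := Function.ne_iff.1 hu.1
  have hdvd : X ^ m ∣ u j * M.det := by
    have hdet : u j * M.det = (M.adjugate *ᵥ (M *ᵥ u)) j := by
      rw [mulVec_mulVec, adjugate_mul, smul_mulVec, one_mulVec, Pi.smul_apply, smul_eq_mul,
        mul_comm]
    rw [hdet]
    exact Finset.dvd_sum fun i _ => (hu.2 i).mul_left _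
  refine prime_X.pow_dvd_of_dvd_mul_left m (fun h => hj ?_) hdvd
  exact X_dvd_iff.1 h

/-- A nonzero column of the adjugate, stripped of its power of `X`, is a root polynomial. -/
theorem X_pow_sub_dvd_adjugate {v m : ℕ} (hv : X ^ v ∣ M.det)
    (hm : ∀ k u, IsRootPolynomial M k u → k ≤ m) (i j : ι) :
    X ^ (v - m) ∣ M.adjugate i j := by
  by_cases hcol : M.adjugate.col j = 0
  · rw [show M.adjugate i j = 0 from congrFun hcol i]
    exact dvd_zero _
  obtain ⟨w, u, hw, hu⟩ := exists_eq_X_pow_smul_coeff_zero_ne_zero hcol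
  have hle : v - w ≤ m := by
    refine hm _ u ⟨hu, fun k => ?_⟩
    have hmul : X ^ w * (M *ᵥ u) k = M.det * (1 : Matrix ι ι R[X]) k j := by
      have := congrFun (congrArg (M *ᵥ ·) hw) k
      simp only [mulVec_smul, Pi.smul_apply, smul_eq_mul] at this
      rw [← this]
      exact (congrFun (congrFun (mul_adjugate M) k) j)
    rcases le_total v w with h | h
    · simp [Nat.sub_eq_zero_of_le h]
    · rw [← mul_dvd_mul_iff_left (pow_ne_zero w (X_ne_zero (R := R))), hmul, ← pow_add,
        Nat.add_sub_cancel' h]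
      exact hv.mul_right _
  rw [show M.adjugate i j = X ^ w * u i from congrFun hw i]
  exact (pow_dvd_pow X (by omega)).mul_right _

end PolynomialMatrices

section RankOne

open Matrix

variable {ι R : Type*} [Fintype ι] [DecidableEq ι] [CommRing R]

theorem det_smul_one_add_vecMulVec [Nonempty ι] (d : R) (u v : ι → R) :
    (d • (1 : Matrix ι ι R) + vecMulVec u v).det =
      d ^ (Fintype.card ι - 1) * (d + u ⬝ᵥ v) := by
  have h := Matrix.eval_charpoly (vecMulVec (-u) v) d
  rw [charpoly_vecMulVec] at h
  have hs : scalar ι d - vecMulVec (-u) v = d • (1 : Matrix ι ι R) + vecMulVec u v := by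
    rw [neg_vecMulVec, sub_neg_eq_add, smul_one_eq_diagonal]; rfl
  rw [← hs, ← h]
  obtain ⟨k, hk⟩ := Nat.exists_eq_succ_of_ne_zero (Fintype.card_ne_zero (α := ι))
  simp [hk, pow_succ]
  ring

variable [IsDomain R]

theorem det_add_vecMulVec {M : Matrix ι ι R} (hM : M.det ≠ 0) (u v : ι → R) :
    (M + vecMulVec u v).det = M.det + (M.adjugate *ᵥ u) ⬝ᵥ v := by
  cases isEmpty_or_nonempty ι
  · simp
  have hadj : M.adjugate * (M + vecMulVec u v) =
      M.det • (1 : Matrix ι ι R) + vecMulVec (M.adjugate *ᵥ u) v := by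
    rw [mul_add, adjugate_mul, mul_vecMulVec]
  have hdet := congrArg det hadj
  rw [det_mul, det_adjugate, det_smul_one_add_vecMulVec] at hdet
  exact mul_left_cancel₀ (pow_ne_zero _ hM) hdet

theorem det_add_of_mul_eq_mul {M Q : Matrix ι ι R} (hM : M.det ≠ 0)
    (hQ : ∀ i j k l, Q i j * Q k l = Q i l * Q k j) :
    (M + Q).det = M.det + (M.adjugate * Q).trace := by
  by_cases hQ0 : Q = 0
  · simp [hQ0]
  obtain ⟨a, b, hq⟩ : ∃ a b, Q a b ≠ 0 := by
    by_contra! h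
    exact hQ0 (Matrix.ext h)
  have : Nonempty ι := ⟨a⟩
  have hQsmul : Q a b • Q = vecMulVec (Q.col b) (Q.row a) := by
    ext i j
    rw [Matrix.smul_apply, smul_eq_mul, hQ, mul_comm, vecMulVec_apply, col_apply, row_apply]
  have htrace : ((Q a b • M).adjugate *ᵥ Q.col b) ⬝ᵥ Q.row a =
      Q a b ^ Fintype.card ι * (M.adjugate * Q).trace := by
    rw [← trace_vecMulVec, ← mul_vecMulVec, ← hQsmul, adjugate_smul, smul_mul_smul_comm,
      trace_smul, smul_eq_mul, pow_sub_one_mul Fintype.card_ne_zero]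
  have hdet := congrArg det (smul_add (Q a b) M Q)
  rw [hQsmul, det_add_vecMulVec (by simp [hq, hM]), htrace, det_smul, det_smul,
    ← mul_add] at hdet
  exact mul_left_cancel₀ (pow_ne_zero _ hq) hdet

theorem dvd_det_add_of_mul_eq_mul {M Q : Matrix ι ι R} (hM : M.det ≠ 0)
    (hQ : ∀ i j k l, Q i j * Q k l = Q i l * Q k j) {r : R} (hr : r ∣ M.det)
    (hadj : ∀ i j, r ∣ M.adjugate i j) : r ∣ (M + Q).det := by
  rw [det_add_of_mul_eq_mul hM hQ]
  exact hr.add (Finset.dvd_sum fun i _ => Finset.dvd_sum fun j _ => (hadj i j).mul_right _)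

end RankOne

section GeneralizedEigenspaces

open Module End

variable {𝕜 V : Type*} [Field 𝕜] [AddCommGroup V] [Module 𝕜 V] {T : End 𝕜 V} {c : 𝕜}

theorem mem_maxGenEigenspace_inv_of_eq_apply (hc : c ≠ 0) {x y : V}
    (hy : y ∈ T.maxGenEigenspace c⁻¹) (hxy : x = T (c • x + y)) :
    x ∈ T.maxGenEigenspace c⁻¹ := by
  obtain ⟨k, hk⟩ := (T.mem_maxGenEigenspace _ _).1 hy
  refine (T.mem_maxGenEigenspace _ _).2 ⟨k + 1, ?_⟩
  have hcomm : Commute ((T - c⁻¹ • (1 : End 𝕜 V)) ^ k) T :=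
    ((Commute.refl T).sub_left ((Commute.one_left T).smul_left _)).pow_left k
  have hstep : (T - c⁻¹ • (1 : End 𝕜 V)) x = -(c⁻¹ • T y) := by
    have : T y = x - c • T x := by
      rw [map_add, map_smul] at hxy
      exact eq_sub_of_add_eq' hxy.symm
    simp [this, smul_sub, hc]
  rw [pow_succ, mul_apply, hstep, map_neg, map_smul, ← mul_apply, hcomm.eq, mul_apply, hk,
    map_zero, smul_zero, neg_zero]

variable [FiniteDimensional 𝕜 V]

theorem exists_mem_genEigenspace_apply_eq {μ : 𝕜} (hμ : μ ≠ 0) {k : ℕ∞} {x : V}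
    (hx : x ∈ T.genEigenspace μ k) : ∃ y ∈ T.genEigenspace μ k, T y = x := by
  have hmaps : Set.MapsTo T (T.genEigenspace μ k) (T.genEigenspace μ k) :=
    mapsTo_genEigenspace_of_comm (Commute.refl T) μ k
  have hinj : Function.Injective (T.restrict hmaps) := by
    have hdisj := T.disjoint_genEigenspace hμ k 1
    rw [genEigenspace_one, zero_smul, sub_zero] at hdisj
    exact (LinearMap.injective_restrict_iff hmaps).2 hdisj
  obtain ⟨y, hy⟩ := LinearMap.injective_iff_surjective.1 hinj ⟨x, hx⟩
  exact ⟨y, y.2, congrArg Subtype.val hy⟩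

theorem maxGenEigenspace_inv_le (hc : c ≠ 0) {W : Submodule 𝕜 V}
    (hW : ∀ x y, y ∈ W → x = T (c • x + y) → x ∈ W) : T.maxGenEigenspace c⁻¹ ≤ W := by
  have hle : ∀ k : ℕ, T.genEigenspace c⁻¹ k ≤ W := fun k => by
    induction k with
    | zero => simp
    | succ k ih =>
      intro x hx
      obtain ⟨z, hz, hzx⟩ := exists_mem_genEigenspace_apply_eq (inv_ne_zero hc) hx
      refine hW x (z - c • x) (ih ?_) (by simp [hzx])
      have hzx' : z - c • x = -(c • (T - c⁻¹ • (1 : End 𝕜 V)) z) := by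
        simp [hzx, smul_sub, hc]
      rw [hzx']
      refine neg_mem (Submodule.smul_mem _ _ ?_)
      rw [mem_genEigenspace_nat, LinearMap.mem_ker] at hz ⊢
      rwa [pow_succ, mul_apply] at hz
  intro x hx
  obtain ⟨k, hk⟩ := (T.mem_maxGenEigenspace _ _).1 hx
  exact hle k (mem_genEigenspace_nat.2 hk)

end GeneralizedEigenspaces

section Polynomials

open Polynomial

theorem eq_of_eval_eq_of_ne_zero {R : Type*} [CommRing R] [IsDomain R] [Infinite R] {p q : R[X]}
    (h : ∀ x, x ≠ 0 → p.eval x = q.eval x) : p = q :=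
  eq_of_infinite_eval_eq p q ((Set.finite_singleton 0).infinite_compl.mono h)

theorem natTrailingDegree_reflect {R : Type*} [Semiring R] {p : R[X]} (hp : p ≠ 0)
    {N : ℕ} (hN : p.natDegree ≤ N) : (p.reflect N).natTrailingDegree = N - p.natDegree := by
  have hreverse : p.reflect N = p.reverse * X ^ (N - p.natDegree) := by
    have h := reflect_mul p 1 le_rfl (natDegree_one.le.trans (Nat.zero_le (N - p.natDegree)))
    rwa [mul_one, Nat.add_sub_cancel' hN, reflect_one] at h
  rw [hreverse, natTrailingDegree_mul_X_pow (mt reverse_eq_zero.1 hp),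
    natTrailingDegree_reverse, zero_add]

theorem rootMultiplicity_reverse {R : Type*} [Field R] {p : R[X]} (hp : p ≠ 0) {c : R}
    (hc : c ≠ 0) : p.reverse.rootMultiplicity c = p.rootMultiplicity c⁻¹ := by
  have hlin : (X - C c⁻¹ : R[X]).reverse = C (-c⁻¹) * (X - C c) := by
    have hX : (X : R[X]).reverse = 1 := by
      rw [← one_mul X, reverse_mul_X, ← C_1, reverse_C]
    rw [sub_eq_add_neg, ← C_neg, reverse_add_C, hX, natDegree_X, pow_one, mul_sub, ← C_mul]
    simp [hc, sub_eq_add_neg, add_comm]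
  have hpow : ∀ m : ℕ, ((X - C c⁻¹ : R[X]) ^ m).reverse = C ((-c⁻¹) ^ m) * (X - C c) ^ m := by
    intro m
    induction m with
    | zero => simpa using reverse_C (1 : R)
    | succ m ih => rw [pow_succ, reverse_mul_of_domain, ih, hlin, pow_succ, pow_succ, C_mul]; ring
  obtain ⟨q, hpq, hq⟩ := exists_eq_pow_rootMultiplicity_mul_and_not_dvd p hp c⁻¹
  have hroot : ¬ q.reverse.IsRoot c := by
    let := invertibleOfNonzero (inv_ne_zero hc)
    rw [dvd_iff_isRoot, IsRoot.def, ← eval₂_id, ← eval₂_reverse_eq_zero_iff, invOf_eq_inv,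
      inv_inv, eval₂_id] at hq
    exact hq
  have hq0 : q.reverse ≠ 0 := fun h => hroot (by simp [h])
  conv_lhs => rw [hpq, reverse_mul_of_domain, hpow]
  have hunit : C ((-c⁻¹) ^ p.rootMultiplicity c⁻¹) ≠ 0 := by simp [hc]
  rw [mul_right_comm, rootMultiplicity_mul_X_sub_C_pow (mul_ne_zero hunit hq0),
    rootMultiplicity_mul (mul_ne_zero hunit hq0), rootMultiplicity_C,
    rootMultiplicity_eq_zero hroot, zero_add, zero_add]

theorem finsum_rootMultiplicity {𝕜 : Type*} [Field 𝕜] [IsAlgClosed 𝕜] (p : 𝕜[X]) :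
    ∑ᶠ z, p.rootMultiplicity z = p.natDegree := by
  classical
  rw [← IsAlgClosed.card_roots_eq_natDegree, ← Multiset.toFinset_sum_count_eq]
  simp only [count_roots]
  refine finsum_eq_sum_of_support_subset _ fun z hz => ?_
  rw [Finset.mem_coe, Multiset.mem_toFinset, ← Multiset.count_pos, count_roots]
  exact Nat.pos_of_ne_zero hz

end Polynomials

section Multiplicity

open Polynomial Matrix

theorem charpolyRev_comp {S ι : Type*} [CommRing S] [Fintype ι] [DecidableEq ι]
    (T : Matrix ι ι S) (q : S[X]) : T.charpolyRev.comp q = (1 - q • T.map C).det := by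
  rw [charpolyRev, ← coe_compRingHom_apply, RingHom.map_det]
  congr 1
  ext i j : 1
  simp [one_apply, apply_ite (fun p : S[X] => p.comp q), mul_comm q]

variable {𝕜 ι : Type*} [Field 𝕜] [Fintype ι] [DecidableEq ι] {K R : Matrix ι ι 𝕜} {c : 𝕜}

theorem det_X_smul_sub_eq_charpolyRev_comp (hN : (K + c • R).det ≠ 0) :
    ((X : 𝕜[X]) • R.map C - K.map C).det =
      C ((-1) ^ Fintype.card ι * (K + c • R).det) *
        ((K + c • R)⁻¹ * R).charpolyRev.comp (X + C c) := by
  have hNR : (K + c • R).map C * ((K + c • R)⁻¹ * R).map C = (R.map C : Matrix ι ι 𝕜[X]) := by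
    rw [← Matrix.map_mul, mul_nonsing_inv_cancel_left _ _ (isUnit_iff_ne_zero.2 hN)]
  have hfactor : (X : 𝕜[X]) • R.map C - K.map C =
      -((K + c • R).map C * (1 - (X + C c) • ((K + c • R)⁻¹ * R).map C)) := by
    rw [mul_sub, mul_smul_comm, hNR, mul_one]
    ext1 i j
    simp
    ring
  rw [hfactor, det_neg, det_mul, charpolyRev_comp, ← RingHom.mapMatrix_apply, ← RingHom.map_det]
  simp [mul_assoc]

theorem natTrailingDegree_det_X_smul_sub (hc : c ≠ 0) (hN : (K + c • R).det ≠ 0) :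
    ((X : 𝕜[X]) • R.map C - K.map C).det.natTrailingDegree =
      ((K + c • R)⁻¹ * R).charpoly.rootMultiplicity c⁻¹ := by
  have hchar := (charpoly_monic ((K + c • R)⁻¹ * R)).ne_zero
  have hrev : ((K + c • R)⁻¹ * R).charpolyRev.comp (X + C c) ≠ 0 := by
    rw [← reverse_charpoly]
    simpa [comp_X_add_C_eq_zero_iff] using hchar
  rw [det_X_smul_sub_eq_charpolyRev_comp hN, natTrailingDegree_mul (by simp [hN]) hrev,
    natTrailingDegree_C, zero_add, ← rootMultiplicity_eq_natTrailingDegree, ← reverse_charpoly,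
    rootMultiplicity_reverse hchar hc]

theorem finrank_maxGenEigenspace_inv (hc : c ≠ 0) (hN : (K + c • R).det ≠ 0) :
    Module.finrank 𝕜 (Module.End.maxGenEigenspace (toLin' ((K + c • R)⁻¹ * R)) c⁻¹) =
      ((X : 𝕜[X]) • R.map C - K.map C).det.natTrailingDegree := by
  rw [LinearMap.finrank_maxGenEigenspace_eq, charpoly_toLin',
    natTrailingDegree_det_X_smul_sub hc hN]

theorem mulVec_eq_mulVec_iff (hN : (K + c • R).det ≠ 0) {x y : ι → 𝕜} :
    K *ᵥ x = R *ᵥ y ↔ x = toLin' ((K + c • R)⁻¹ * R) (c • x + y) := by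
  have hu : IsUnit (K + c • R).det := isUnit_iff_ne_zero.2 hN
  have hiff : K *ᵥ x = R *ᵥ y ↔ (K + c • R) *ᵥ x = R *ᵥ (c • x + y) := by
    rw [add_mulVec, smul_mulVec, mulVec_add, mulVec_smul, add_comm, add_right_inj]
  rw [hiff, toLin'_apply, ← mulVec_mulVec]
  refine ⟨fun h => ?_, fun h => ?_⟩
  · rw [← h, mulVec_mulVec, nonsing_inv_mul _ hu, one_mulVec]
  · conv_lhs => rw [h]
    rw [mulVec_mulVec, mul_nonsing_inv _ hu, one_mulVec]

end Multiplicity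

section Finsum

variable {α : Type*} {f g m : α → ℕ}

theorem finsum_mem_le_finsum_mem_add (hg : g.support.Finite) (hm : m.support.Finite)
    (hle : f ≤ g + m) (U : Set α) : ∑ᶠ a ∈ U, f a ≤ ∑ᶠ a ∈ U, g a + ∑ᶠ a ∈ U, m a := by
  have hsum : (g + m).support.Finite := (hg.union hm).subset (Function.support_add g m)
  have hf : f.support.Finite := hsum.subset fun a ha h => ha (Nat.le_zero.1 (h ▸ hle a))
  rw [← finsum_mem_add_distrib' (hg.inter_of_right U) (hm.inter_of_right U), finsum_mem_def,
    finsum_mem_def]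
  refine finsum_le_finsum' ?_ ?_ fun a => Set.indicator_le_indicator (hle a)
  · exact (hf.inter_of_right U).subset Set.support_indicator.subset
  · exact (hsum.inter_of_right U).subset Set.support_indicator.subset

theorem finsum_mem_eq_finsum_of_support_subset {M : Type*} [AddCommMonoid M] {h : α → M}
    {U : Set α} (hU : h.support ⊆ U) : ∑ᶠ a ∈ U, h a = ∑ᶠ a, h a := by
  rw [finsum_mem_def, Set.indicator_eq_self.2 hU]

theorem finsum_mem_add_finsum_mem_compl {M : Type*} [AddCommMonoid M] {h : α → M}
    (hh : h.support.Finite) (U : Set α) :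
    ∑ᶠ a ∈ U, h a + ∑ᶠ a ∈ Uᶜ, h a = ∑ᶠ a, h a := by
  rw [← finsum_mem_univ h, Set.compl_eq_univ_sdiff]
  exact finsum_mem_add_sdiff' U.subset_univ (hh.inter_of_right _)

theorem finsum_mem_add_finsum_mem_le (hf : f.support.Finite) (hg : g.support.Finite)
    (hm : m.support.Finite) (hle : f ≤ g + m) (hfg : ∑ᶠ a, f a = ∑ᶠ a, g a) (U : Set α) :
    ∑ᶠ a ∈ U, g a + ∑ᶠ a ∈ U, m a ≤ ∑ᶠ a ∈ U, f a + ∑ᶠ a, m a := by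
  have hcompl := finsum_mem_le_finsum_mem_add hg hm hle Uᶜ
  have := finsum_mem_add_finsum_mem_compl hf U
  have := finsum_mem_add_finsum_mem_compl hg U
  have := finsum_mem_add_finsum_mem_compl hm U
  omega

theorem finsum_onePoint {M : Type*} [AddCommMonoid M] {f : OnePoint α → M}
    (hf : f.support.Finite) : ∑ᶠ l, f l = f OnePoint.infty + ∑ᶠ a : α, f a := by
  rw [← finsum_mem_univ f, ← OnePoint.insert_infty_range_coe,
    finsum_mem_insert' f OnePoint.infty_notMem_range_coe (hf.inter_of_right _),
    finsum_mem_range OnePoint.coe_injective]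

end Finsum

namespace MatrixPencil

open Polynomial Matrix

variable {n : ℕ} {𝒜 P : MatrixPencil n} {l : OnePoint ℂ}

/-- The pencil `𝒜` in a local coordinate `s` at `l`, that is `𝒜(l + s)` for finite `l` and
`-s 𝒜(1 / s)` for `l = ∞`: the Jordan chains of `𝒜` at `l` are those of `𝒜.localPencil l` at `0`. -/
def localPencil (𝒜 : MatrixPencil n) (l : OnePoint ℂ) : MatrixPencil n :=
  ⟨(𝒜.chainMatrices l).2, (𝒜.chainMatrices l).1⟩

/-- The algebraic multiplicity of `l` as an eigenvalue of `𝒜`: the order of vanishing at `l` of the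
determinant, taken in the local coordinate of `localPencil`. -/
noncomputable def algebraicMultiplicity (𝒜 : MatrixPencil n) (l : OnePoint ℂ) : ℕ :=
  (𝒜.localPencil l).toPolyMatrix.det.natTrailingDegree

theorem eval_toPolyMatrix_apply (𝒜 : MatrixPencil n) (z : ℂ) (i j : Fin n) :
    (𝒜.toPolyMatrix i j).eval z = 𝒜.eval z i j := by
  simp [toPolyMatrix, MatrixPencil.eval, mul_comm z]

theorem toPolyMatrix_add (𝒜 P : MatrixPencil n) :
    (𝒜 + P).toPolyMatrix = 𝒜.toPolyMatrix + P.toPolyMatrix := by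
  refine Matrix.ext fun i j => Polynomial.funext fun z => ?_
  change (toPolyMatrix ⟨𝒜.E + P.E, 𝒜.A + P.A⟩ i j).eval z = _
  simp [eval_toPolyMatrix_apply, MatrixPencil.eval]
  ring

theorem localPencil_add (𝒜 P : MatrixPencil n) (l : OnePoint ℂ) :
    (𝒜 + P).localPencil l = 𝒜.localPencil l + P.localPencil l := by
  induction l using OnePoint.rec with
  | infty => rfl
  | coe z =>
    refine MatrixPencil.ext rfl ?_
    change 𝒜.A + P.A - z • (𝒜.E + P.E) = 𝒜.A - z • 𝒜.E + (P.A - z • P.E)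
    rw [smul_add, add_sub_add_comm]

theorem localPencil_coe_eval (𝒜 : MatrixPencil n) (z x : ℂ) :
    (𝒜.localPencil z).eval x = 𝒜.eval (x + z) := by
  change x • 𝒜.E - (𝒜.A - z • 𝒜.E) = (x + z) • 𝒜.E - 𝒜.A
  rw [add_smul, sub_sub_eq_add_sub]

theorem localPencil_infty_eval (𝒜 : MatrixPencil n) {x : ℂ} (hx : x ≠ 0) :
    (𝒜.localPencil OnePoint.infty).eval x = -x • 𝒜.eval x⁻¹ := by
  change x • 𝒜.A - 𝒜.E = -x • (x⁻¹ • 𝒜.E - 𝒜.A)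
  rw [smul_sub, smul_smul, neg_mul, mul_inv_cancel₀ hx, neg_one_smul, neg_smul, sub_neg_eq_add,
    neg_add_eq_sub]

theorem natDegree_det_toPolyMatrix_le (𝒜 : MatrixPencil n) : 𝒜.toPolyMatrix.det.natDegree ≤ n := by
  have h := natDegree_det_X_add_C_le 𝒜.E (-𝒜.A)
  rwa [Fintype.card_fin, Matrix.map_neg C (fun _ => C_neg) 𝒜.A, ← sub_eq_add_neg] at h

theorem det_localPencil_coe (𝒜 : MatrixPencil n) (z : ℂ) :
    (𝒜.localPencil z).toPolyMatrix.det = 𝒜.toPolyMatrix.det.comp (X + C z) := by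
  refine Polynomial.funext fun x => ?_
  rw [eval_comp, eval_det_toPolyMatrix, localPencil_coe_eval, eval_add, eval_X, eval_C,
    eval_det_toPolyMatrix]

theorem det_localPencil_infty (𝒜 : MatrixPencil n) :
    (𝒜.localPencil OnePoint.infty).toPolyMatrix.det =
      C ((-1) ^ n) * 𝒜.toPolyMatrix.det.reflect n := by
  refine eq_of_eval_eq_of_ne_zero fun x hx => ?_
  let := invertibleOfNonzero (inv_ne_zero hx)
  have h := eval₂_reflect_mul_pow (RingHom.id ℂ) x⁻¹ n _ 𝒜.natDegree_det_toPolyMatrix_le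
  rw [invOf_eq_inv, inv_inv, eval₂_id, eval₂_id, eval_det_toPolyMatrix] at h
  rw [eval_det_toPolyMatrix, localPencil_infty_eval _ hx, det_smul, Fintype.card_fin, ← h, neg_pow,
    eval_mul, eval_C, inv_pow]
  field_simp

theorem IsRegular.localPencil (h : 𝒜.IsRegular) (l : OnePoint ℂ) :
    (𝒜.localPencil l).IsRegular := by
  induction l using OnePoint.rec with
  | infty =>
    rw [IsRegular, det_localPencil_infty]
    exact mul_ne_zero (by simp) (mt reflect_eq_zero_iff.1 h)
  | coe z =>
    rw [IsRegular, det_localPencil_coe]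
    exact comp_X_add_C_ne_zero_iff.2 h

theorem algebraicMultiplicity_coe (𝒜 : MatrixPencil n) (z : ℂ) :
    𝒜.algebraicMultiplicity z = 𝒜.toPolyMatrix.det.rootMultiplicity z := by
  rw [algebraicMultiplicity, det_localPencil_coe, rootMultiplicity_eq_natTrailingDegree]

theorem IsRegular.algebraicMultiplicity_infty (h : 𝒜.IsRegular) :
    𝒜.algebraicMultiplicity OnePoint.infty = n - 𝒜.toPolyMatrix.det.natDegree := by
  have hreflect : 𝒜.toPolyMatrix.det.reflect n ≠ 0 := mt reflect_eq_zero_iff.1 h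
  rw [algebraicMultiplicity, det_localPencil_infty, natTrailingDegree_mul (by simp) hreflect,
    natTrailingDegree_C, zero_add, natTrailingDegree_reflect h 𝒜.natDegree_det_toPolyMatrix_le]

theorem algebraicMultiplicity_eq_zero (hl : l ∉ 𝒜.spectrum) : 𝒜.algebraicMultiplicity l = 0 := by
  induction l using OnePoint.rec with
  | infty =>
    have hE : IsUnit 𝒜.E := not_not.1 hl
    refine natTrailingDegree_eq_zero.2 (Or.inr ?_)
    rw [coeff_zero_eq_eval_zero, eval_det_toPolyMatrix]
    change ((0 : ℂ) • 𝒜.A - 𝒜.E).det ≠ 0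
    rw [zero_smul, zero_sub]
    exact ((isUnit_iff_isUnit_det _).1 hE.neg).ne_zero
  | coe z =>
    rw [algebraicMultiplicity_coe]
    exact rootMultiplicity_eq_zero fun hz => hl ((𝒜.coe_mem_spectrum_iff z).2 hz)

theorem support_algebraicMultiplicity_subset (𝒜 : MatrixPencil n) :
    𝒜.algebraicMultiplicity.support ⊆ 𝒜.spectrum :=
  fun _ hl => by_contra fun hn => hl (algebraicMultiplicity_eq_zero hn)

theorem IsRegular.finite_support_algebraicMultiplicity (h : 𝒜.IsRegular) :
    𝒜.algebraicMultiplicity.support.Finite :=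
  h.finite_spectrum.subset 𝒜.support_algebraicMultiplicity_subset

theorem IsRegular.finsum_algebraicMultiplicity (h : 𝒜.IsRegular) :
    ∑ᶠ l, 𝒜.algebraicMultiplicity l = n := by
  rw [finsum_onePoint h.finite_support_algebraicMultiplicity, h.algebraicMultiplicity_infty]
  simp only [algebraicMultiplicity_coe]
  rw [finsum_rootMultiplicity, Nat.sub_add_cancel 𝒜.natDegree_det_toPolyMatrix_le]

theorem coeff_zero_toPolyMatrix_mulVec (𝒜 : MatrixPencil n) (u : Fin n → ℂ[X]) (k : Fin n) :
    ((𝒜.toPolyMatrix *ᵥ u) k).coeff 0 = -(𝒜.A *ᵥ fun i => (u i).coeff 0) k := by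
  simp [toPolyMatrix, mulVec, dotProduct, finsetSum_coeff, sub_mul, mul_coeff_zero]

theorem coeff_succ_toPolyMatrix_mulVec (𝒜 : MatrixPencil n) (u : Fin n → ℂ[X]) (k : Fin n)
    (d : ℕ) : ((𝒜.toPolyMatrix *ᵥ u) k).coeff (d + 1) =
      (𝒜.E *ᵥ fun i => (u i).coeff d) k - (𝒜.A *ᵥ fun i => (u i).coeff (d + 1)) k := by
  simp [toPolyMatrix, mulVec, dotProduct, finsetSum_coeff, sub_mul, mul_assoc]

theorem isRootPolynomial_localPencil_iff {m : ℕ} (hm : 0 < m) {u : Fin n → ℂ[X]}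
    {g : ℕ → Fin n → ℂ} (hg : ∀ d < m, (fun i => (u i).coeff d) = g d) :
    IsRootPolynomial (𝒜.localPencil l).toPolyMatrix m u ↔ 𝒜.IsJordanChain l m g := by
  have hcoeff : (∀ k, X ^ m ∣ ((𝒜.localPencil l).toPolyMatrix *ᵥ u) k) ↔
      ∀ d < m, ∀ k, (((𝒜.localPencil l).toPolyMatrix *ᵥ u) k).coeff d = 0 := by
    simp only [X_pow_dvd_iff]
    exact ⟨fun h d hd k => h k d hd, fun h k d hd => h d hd k⟩
  rw [isJordanChain_iff, IsRootPolynomial, hcoeff, hg 0 hm, and_iff_right hm]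
  refine and_congr_right fun _ => ⟨fun h => ⟨funext fun k => ?_, fun d hd => funext fun k => ?_⟩,
    fun h d hd k => ?_⟩
  · have := h 0 hm k
    rwa [coeff_zero_toPolyMatrix_mulVec, hg 0 hm, neg_eq_zero] at this
  · have := h (d + 1) hd k
    rw [coeff_succ_toPolyMatrix_mulVec, hg d (by omega), hg _ hd, sub_eq_zero] at this
    exact this.symm
  · cases d with
    | zero =>
      rw [coeff_zero_toPolyMatrix_mulVec, hg 0 hm, neg_eq_zero]
      exact congrFun h.1 k
    | succ d =>
      rw [coeff_succ_toPolyMatrix_mulVec, hg d (by omega), hg _ hd, sub_eq_zero]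
      exact (congrFun (h.2 d hd) k).symm

theorem IsJordanChain.exists_isRootPolynomial {m : ℕ} {g : ℕ → Fin n → ℂ}
    (hg : 𝒜.IsJordanChain l m g) :
    ∃ u, IsRootPolynomial (𝒜.localPencil l).toPolyMatrix m u := by
  refine ⟨fun k => ∑ d ∈ Finset.range m, monomial d (g d k),
    (isRootPolynomial_localPencil_iff hg.1 fun d hd => funext fun k => ?_).2 hg⟩
  simp [finsetSum_coeff, coeff_monomial, hd]

theorem IsJordanChain.le_algebraicMultiplicity (h : 𝒜.IsRegular) {m : ℕ}
    {g : ℕ → Fin n → ℂ} (hg : 𝒜.IsJordanChain l m g) : m ≤ 𝒜.algebraicMultiplicity l := by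
  obtain ⟨u, hu⟩ := hg.exists_isRootPolynomial
  exact (X_pow_dvd_iff_le_natTrailingDegree (h.localPencil l)).1 hu.X_pow_dvd_det

theorem IsJordanChain.le_maxChainLength (h : 𝒜.IsRegular) {m : ℕ} {g : ℕ → Fin n → ℂ}
    (hg : 𝒜.IsJordanChain l m g) : m ≤ 𝒜.maxChainLength l :=
  le_csSup ⟨_, fun _ ⟨_, hg'⟩ => hg'.le_algebraicMultiplicity h⟩ ⟨g, hg⟩

theorem IsRegular.maxChainLength_le_algebraicMultiplicity (h : 𝒜.IsRegular) (l : OnePoint ℂ) :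
    𝒜.maxChainLength l ≤ 𝒜.algebraicMultiplicity l :=
  csSup_le' fun _ ⟨_, hg⟩ => hg.le_algebraicMultiplicity h

theorem IsRegular.maxChainLength_eq_zero (h : 𝒜.IsRegular) (hl : l ∉ 𝒜.spectrum) :
    𝒜.maxChainLength l = 0 :=
  Nat.le_zero.1 <|
    (h.maxChainLength_le_algebraicMultiplicity l).trans_eq (algebraicMultiplicity_eq_zero hl)

theorem IsRegular.support_maxChainLength_subset (h : 𝒜.IsRegular) :
    𝒜.maxChainLength.support ⊆ 𝒜.spectrum :=
  fun _ hl => by_contra fun hn => hl (h.maxChainLength_eq_zero hn)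

theorem IsRegular.finite_support_maxChainLength (h : 𝒜.IsRegular) :
    𝒜.maxChainLength.support.Finite :=
  h.finite_spectrum.subset h.support_maxChainLength_subset

theorem IsRegular.finsum_maxChainLength (h : 𝒜.IsRegular) :
    ∑ᶠ l, 𝒜.maxChainLength l = 𝒜.sumMaxChainLength :=
  (finsum_mem_eq_finsum_of_support_subset h.support_maxChainLength_subset).symm

theorem mem_rootSubspace_of_mulVec_eq {x y : Fin n → ℂ} (hy : y ∈ 𝒜.rootSubspace l)
    (hxy : (𝒜.chainMatrices l).1 *ᵥ x = (𝒜.chainMatrices l).2 *ᵥ y) : x ∈ 𝒜.rootSubspace l := by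
  rw [← SetLike.mem_coe, coe_rootSubspace] at hy
  rcases hy with rfl | ⟨m, g, hg, j, hj, rfl⟩
  · by_cases hx : x = 0
    · exact hx ▸ zero_mem _
    refine Submodule.subset_span ⟨1, fun _ => x, ?_, 0, one_pos, rfl⟩
    exact (isJordanChain_iff ..).2 ⟨one_pos, hx, by rw [hxy, mulVec_zero], by simp⟩
  · obtain ⟨-, hg0, hK, hR⟩ := (isJordanChain_iff ..).1 hg
    refine Submodule.subset_span ⟨j + 2, Function.update g (j + 1) x,
      (isJordanChain_iff ..).2 ⟨by omega, ?_, ?_, fun i hi => ?_⟩, j + 1, by omega, by simp⟩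
    · rwa [Function.update_of_ne (by omega)]
    · rwa [Function.update_of_ne (by omega)]
    · rw [Function.update_of_ne (a := i) (by omega)]
      obtain rfl | hij := eq_or_ne i j
      · rwa [Function.update_self]
      · rw [Function.update_of_ne (by omega)]
        exact hR i (by omega)

theorem rootSubspace_le {W : Submodule ℂ (Fin n → ℂ)}
    (hW : ∀ x y, y ∈ W → (𝒜.chainMatrices l).1 *ᵥ x = (𝒜.chainMatrices l).2 *ᵥ y → x ∈ W) :
    𝒜.rootSubspace l ≤ W := by
  refine Submodule.span_le.2 ?_
  rintro _ ⟨m, g, hg, j, hj, rfl⟩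
  obtain ⟨-, -, hK, hR⟩ := (isJordanChain_iff ..).1 hg
  induction j with
  | zero => exact hW _ 0 (zero_mem _) (by rw [hK, mulVec_zero])
  | succ j ih => exact hW _ _ (ih (by omega)) (hR j hj)

theorem rootSubspace_eq_maxGenEigenspace {c : ℂ} (hc : c ≠ 0)
    (hN : ((𝒜.chainMatrices l).1 + c • (𝒜.chainMatrices l).2).det ≠ 0) :
    𝒜.rootSubspace l = Module.End.maxGenEigenspace
      (toLin' (((𝒜.chainMatrices l).1 + c • (𝒜.chainMatrices l).2)⁻¹ * (𝒜.chainMatrices l).2))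
      c⁻¹ :=
  le_antisymm
    (rootSubspace_le fun _ _ hy hxy =>
      mem_maxGenEigenspace_inv_of_eq_apply hc hy ((mulVec_eq_mulVec_iff hN).1 hxy))
    (maxGenEigenspace_inv_le hc fun _ _ hy hxy =>
      mem_rootSubspace_of_mulVec_eq hy ((mulVec_eq_mulVec_iff hN).2 hxy))

theorem IsRegular.exists_det_add_smul_ne_zero (h : 𝒜.IsRegular) :
    ∃ c : ℂ, c ≠ 0 ∧ (𝒜.A + c • 𝒜.E).det ≠ 0 := by
  by_contra! hdet
  refine h (eq_of_eval_eq_of_ne_zero fun x hx => ?_)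
  rw [eval_zero, eval_det_toPolyMatrix, MatrixPencil.eval, ← neg_sub, sub_eq_add_neg, ← neg_smul,
    det_neg, hdet _ (neg_ne_zero.2 hx), mul_zero]

theorem IsRegular.finrank_rootSubspace (h : 𝒜.IsRegular) (l : OnePoint ℂ) :
    Module.finrank ℂ (𝒜.rootSubspace l) = 𝒜.algebraicMultiplicity l := by
  obtain ⟨c, hc, hN⟩ := (h.localPencil l).exists_det_add_smul_ne_zero
  exact (rootSubspace_eq_maxGenEigenspace hc hN) ▸ finrank_maxGenEigenspace_inv hc hN

theorem IsRegular.finrank_rootSubspace_eq_zero (h : 𝒜.IsRegular) (hl : l ∉ 𝒜.spectrum) :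
    Module.finrank ℂ (𝒜.rootSubspace l) = 0 :=
  (h.finrank_rootSubspace l).trans (algebraicMultiplicity_eq_zero hl)

theorem IsRegular.finsum_mem_spectrum_finrank_rootSubspace (h : 𝒜.IsRegular) :
    ∑ᶠ l ∈ 𝒜.spectrum, Module.finrank ℂ (𝒜.rootSubspace l) = n := by
  simp only [h.finrank_rootSubspace]
  rw [finsum_mem_eq_finsum_of_support_subset 𝒜.support_algebraicMultiplicity_subset,
    h.finsum_algebraicMultiplicity]

theorem toPolyMatrix_mul_eq_mul_of_rank_le_one (hP : P.rank ≤ 1) (i j k m : Fin n) :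
    P.toPolyMatrix i j * P.toPolyMatrix k m = P.toPolyMatrix i m * P.toPolyMatrix k j := by
  by_contra hne
  have hik : i ≠ k := by
    rintro rfl
    exact hne (mul_comm _ _)
  have hjm : j ≠ m := by
    rintro rfl
    exact hne rfl
  have hinj {a b : Fin n} (hab : a ≠ b) : Function.Injective ![a, b] := by
    intro x y
    fin_cases x <;> fin_cases y <;> simp [hab, hab.symm]
  have hbdd : BddAbove {r : ℕ | ∃ f g : Fin r ↪ Fin n, (P.toPolyMatrix.submatrix f g).det ≠ 0} :=
    ⟨n, fun r ⟨f, _⟩ => by simpa using Fintype.card_le_of_embedding f⟩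
  have htwo : 2 ≤ P.rank := by
    refine le_csSup hbdd ⟨⟨![i, k], hinj hik⟩, ⟨![j, m], hinj hjm⟩, ?_⟩
    rw [det_fin_two]
    simpa [sub_eq_zero] using hne
  omega

theorem localPencil_toPolyMatrix_mul_eq_mul (hP : P.rank ≤ 1) (l : OnePoint ℂ)
    (i j k m : Fin n) :
    (P.localPencil l).toPolyMatrix i j * (P.localPencil l).toPolyMatrix k m =
      (P.localPencil l).toPolyMatrix i m * (P.localPencil l).toPolyMatrix k j := by
  refine eq_of_eval_eq_of_ne_zero fun x hx => ?_
  have heval : ∃ a y : ℂ, (P.localPencil l).eval x = a • P.eval y := by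
    induction l using OnePoint.rec with
    | infty => exact ⟨-x, x⁻¹, P.localPencil_infty_eval hx⟩
    | coe z => exact ⟨1, x + z, by rw [one_smul, localPencil_coe_eval]⟩
  obtain ⟨a, y, hay⟩ := heval
  have hminor := congrArg (Polynomial.eval y) (toPolyMatrix_mul_eq_mul_of_rank_le_one hP i j k m)
  simp only [eval_mul, eval_toPolyMatrix_apply] at hminor
  simp only [eval_mul, eval_toPolyMatrix_apply, hay, Matrix.smul_apply, smul_eq_mul]
  linear_combination a ^ 2 * hminor

theorem algebraicMultiplicity_le_add_maxChainLength (h : 𝒜.IsRegular) (hP : P.rank ≤ 1)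
    (h' : (𝒜 + P).IsRegular) :
    𝒜.algebraicMultiplicity ≤ (𝒜 + P).algebraicMultiplicity + 𝒜.maxChainLength := by
  intro l
  have hreg : (𝒜.localPencil l).toPolyMatrix.det ≠ 0 := h.localPencil l
  have hdet : X ^ 𝒜.algebraicMultiplicity l ∣ (𝒜.localPencil l).toPolyMatrix.det :=
    (X_pow_dvd_iff_le_natTrailingDegree hreg).2 le_rfl
  have hchain (k : ℕ) (u : Fin n → ℂ[X])
      (hu : IsRootPolynomial (𝒜.localPencil l).toPolyMatrix k u) : k ≤ 𝒜.maxChainLength l := by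
    obtain rfl | hk := k.eq_zero_or_pos
    · exact Nat.zero_le _
    · exact ((isRootPolynomial_localPencil_iff hk fun _ _ => rfl).1 hu).le_maxChainLength h
  have hdvd := dvd_det_add_of_mul_eq_mul hreg (localPencil_toPolyMatrix_mul_eq_mul hP l)
    ((pow_dvd_pow X (Nat.sub_le _ (𝒜.maxChainLength l))).trans hdet)
    (X_pow_sub_dvd_adjugate hdet hchain)
  rw [← toPolyMatrix_add, ← localPencil_add,
    X_pow_dvd_iff_le_natTrailingDegree (h'.localPencil l)] at hdvd
  exact tsub_le_iff_right.1 hdvd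

theorem finrank_rootSubspace_le_add_maxChainLength (h : 𝒜.IsRegular) (hP : P.rank ≤ 1)
    (h' : (𝒜 + P).IsRegular) (l : OnePoint ℂ) :
    Module.finrank ℂ (𝒜.rootSubspace l) ≤
      Module.finrank ℂ ((𝒜 + P).rootSubspace l) + 𝒜.maxChainLength l := by
  rw [h.finrank_rootSubspace, h'.finrank_rootSubspace]
  exact algebraicMultiplicity_le_add_maxChainLength h hP h' l

theorem le_finsum_mem_spectrum_finrank_rootSubspace_add (h : 𝒜.IsRegular) (hP : P.rank ≤ 1)
    (h' : (𝒜 + P).IsRegular) :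
    n ≤ ∑ᶠ l ∈ 𝒜.spectrum, Module.finrank ℂ ((𝒜 + P).rootSubspace l) + 𝒜.sumMaxChainLength := by
  refine h.finsum_mem_spectrum_finrank_rootSubspace.ge.trans ?_
  simp only [h.finrank_rootSubspace, h'.finrank_rootSubspace]
  exact finsum_mem_le_finsum_mem_add h'.finite_support_algebraicMultiplicity
    h.finite_support_maxChainLength (algebraicMultiplicity_le_add_maxChainLength h hP h') _

theorem finsum_mem_finrank_rootSubspace_add_le (h : 𝒜.IsRegular) (hP : P.rank ≤ 1)
    (h' : (𝒜 + P).IsRegular) (U : Set (OnePoint ℂ)) :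
    ∑ᶠ l ∈ U, Module.finrank ℂ ((𝒜 + P).rootSubspace l) + ∑ᶠ l ∈ U, 𝒜.maxChainLength l ≤
      ∑ᶠ l ∈ U, Module.finrank ℂ (𝒜.rootSubspace l) + 𝒜.sumMaxChainLength := by
  simp only [h.finrank_rootSubspace, h'.finrank_rootSubspace, ← h.finsum_maxChainLength]
  exact finsum_mem_add_finsum_mem_le h.finite_support_algebraicMultiplicity
    h'.finite_support_algebraicMultiplicity h.finite_support_maxChainLength
    (algebraicMultiplicity_le_add_maxChainLength h hP h')
    (h.finsum_algebraicMultiplicity.trans h'.finsum_algebraicMultiplicity.symm) U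

end MatrixPencil

theorem theorem4p4 {n : ℕ} (𝒜 P : MatrixPencil n) (hA : 𝒜.IsRegular) (hP : P.rank = 1)
    (hAP : (𝒜 + P).IsRegular) :
    (∀ l ∈ 𝒜.spectrum,
      (Module.finrank ℂ (𝒜.rootSubspace l) : ℤ) - 𝒜.maxChainLength l
          ≤ Module.finrank ℂ ((𝒜 + P).rootSubspace l) ∧
      (Module.finrank ℂ ((𝒜 + P).rootSubspace l) : ℤ)
          ≤ Module.finrank ℂ (𝒜.rootSubspace l) + 𝒜.sumMaxChainLength - 𝒜.maxChainLength l) ∧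
    (∀ l ∉ 𝒜.spectrum,
      0 ≤ Module.finrank ℂ ((𝒜 + P).rootSubspace l) ∧
      Module.finrank ℂ ((𝒜 + P).rootSubspace l) ≤ 𝒜.sumMaxChainLength) ∧
    (n : ℤ) - 𝒜.sumMaxChainLength
        ≤ ((∑ᶠ l ∈ 𝒜.spectrum, Module.finrank ℂ ((𝒜 + P).rootSubspace l) : ℕ) : ℤ) ∧
    (∑ᶠ l ∈ (𝒜 + P).spectrum \ 𝒜.spectrum, Module.finrank ℂ ((𝒜 + P).rootSubspace l))
        ≤ 𝒜.sumMaxChainLength := by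
  have hlower := MatrixPencil.finrank_rootSubspace_le_add_maxChainLength hA hP.le hAP
  have hupper := MatrixPencil.finsum_mem_finrank_rootSubspace_add_le hA hP.le hAP
  have hpoint (l : OnePoint ℂ) :
      Module.finrank ℂ ((𝒜 + P).rootSubspace l) + 𝒜.maxChainLength l ≤
        Module.finrank ℂ (𝒜.rootSubspace l) + 𝒜.sumMaxChainLength := by
    simpa only [finsum_mem_singleton] using hupper {l}
  refine ⟨fun l _ => ?_, fun l hl => ⟨Nat.zero_le _, ?_⟩, ?_, ?_⟩
  · have := hlower l
    have := hpoint l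
    omega
  · have := hpoint l
    rw [hA.finrank_rootSubspace_eq_zero hl] at this
    omega
  · have := MatrixPencil.le_finsum_mem_spectrum_finrank_rootSubspace_add hA hP.le hAP
    omega
  · have hzero : ∑ᶠ l ∈ (𝒜 + P).spectrum \ 𝒜.spectrum,
        Module.finrank ℂ (𝒜.rootSubspace l) = 0 :=
      finsum_mem_eq_zero_of_forall_eq_zero fun l hl => hA.finrank_rootSubspace_eq_zero hl.2
    have := hupper ((𝒜 + P).spectrum \ 𝒜.spectrum)
    omega
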